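/- A Seidel matrix of order $n$ is a real symmetric $n\times n$ matrix $S$ with $S_{ii}=0$ for all $i$ and $S_{ij}\in\{1,-1\}$ for all $i\neq j$. The graph $G(S)$ of $S$ has the vertex set $\{1,\dots,n\}$, with distinct $i,j$ adjacent if and only if $S_{ij}=-1$. The switching graph of $S$ is the graph $\mathcal{Sw}(S):=G(S')$ on $2n$ vertices, where $$S'=\begin{pmatrix} S & -S+I\\ -S+I & S\end{pmatrix},$$ which is again a Seidel matrix. The clique number $\omega([S])$ and the independence number $\alpha([S])$ of the switching class $[S]$ are defined as the maximum size of a clique, respectively of an independent set, in $\mathcal{Sw}(S)$. Theorem. Let $S$ be a Seidel matrix of order $n$ whose smallest eigenvalue is $-5$. If $\omega([S])=4$ and $\alpha([S])\leq 28$, then $n\leq 276$. -/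

import Mathlib

/-- A Seidel matrix: a real symmetric matrix with `0` on the diagonal and `1` or `-1` in every
off-diagonal position. -/
structure IsSeidelMatrix {V : Type*} (S : Matrix V V ℝ) : Prop where
  isSymm : S.IsSymm
  diag : ∀ i, S i i = 0
  off_diag : ∀ i j, i ≠ j → S i j = 1 ∨ S i j = -1

/-- The graph of a matrix `S`: distinct vertices `i` and `j` are adjacent when the entry is `-1`.
(`SimpleGraph.fromRel` symmetrizes, which has no effect when `S` is symmetric; see
`seidelGraph_adj`.) -/
def seidelGraph {V : Type*} (S : Matrix V V ℝ) : SimpleGraph V :=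
  SimpleGraph.fromRel fun i j => S i j = -1

theorem seidelGraph_adj {V : Type*} {S : Matrix V V ℝ} (hS : IsSeidelMatrix S) (i j : V) :
    (seidelGraph S).Adj i j ↔ i ≠ j ∧ S i j = -1 := by
  simp [seidelGraph, SimpleGraph.fromRel_adj, hS.isSymm.apply i j]

/-- The doubled matrix with blocks `S`, `-S + I`, `-S + I`, `S`. -/
def switchingMatrix {V : Type*} [DecidableEq V] (S : Matrix V V ℝ) : Matrix (V ⊕ V) (V ⊕ V) ℝ :=
  Matrix.fromBlocks S (-S + 1) (-S + 1) S

theorem IsSeidelMatrix.switchingMatrix {V : Type*} [DecidableEq V] {S : Matrix V V ℝ}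
    (hS : IsSeidelMatrix S) : IsSeidelMatrix (switchingMatrix S) where
  isSymm := by
    have h : (-S + 1 : Matrix V V ℝ).IsSymm := hS.isSymm.neg.add Matrix.isSymm_one
    exact Matrix.IsSymm.fromBlocks hS.isSymm h hS.isSymm
  diag := by
    rintro (i | i) <;> simp [_root_.switchingMatrix, hS.diag]
  off_diag := by
    rintro (i | i) (j | j) hij
    · exact hS.off_diag i j (by simpa using hij)
    · by_cases h : i = j
      · subst h; simp [_root_.switchingMatrix, hS.diag]
      · rcases hS.off_diag i j h with h' | h' <;> simp [_root_.switchingMatrix, h, h']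
    · by_cases h : i = j
      · subst h; simp [_root_.switchingMatrix, hS.diag]
      · rcases hS.off_diag i j h with h' | h' <;> simp [_root_.switchingMatrix, h, h']
    · exact hS.off_diag i j (by simpa using hij)

/-- The switching graph of `S`. -/
def switchingGraph {V : Type*} [DecidableEq V] (S : Matrix V V ℝ) : SimpleGraph (V ⊕ V) :=
  seidelGraph (switchingMatrix S)

/-- The independence number of the switching class of `S`: that of the switching graph. -/
noncomputable def switchingIndepNum {V : Type*} [DecidableEq V] (S : Matrix V V ℝ) : ℕ :=
  (switchingGraph S).indepNum

/-- The clique number of the switching class of `S`: that of the switching graph. -/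
noncomputable def switchingCliqueNum {V : Type*} [DecidableEq V] (S : Matrix V V ℝ) : ℕ :=
  (switchingGraph S).cliqueNum

/-- `μ` is the smallest eigenvalue of the matrix `S`. -/
def IsSmallestEigenvalue {V : Type*} [Fintype V] [DecidableEq V] (S : Matrix V V ℝ) (μ : ℝ) :
    Prop :=
  IsLeast {t : ℝ | Module.End.HasEigenvalue (Matrix.toLin' S) t} μ

/-! A triple is negative when the product of its three entries is -1. This sign is invariant under
switching, and among the four triples of a 4-set an even number are negative. For u ≠ v, the link
graph lives on the w with uvw negative, and w, x are adjacent when uwx (hence also vwx) is negative.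
Since ω = 4 it is triangle-free. Since α ≤ 28 its independent sets have at most 27 elements. Since S
+ 5I is positive semidefinite, its adjacency matrix satisfies A ≤ 2I + J/4.

The core is `IsLinkGraph.three_mul_card_le`: such a graph with N vertices and degrees at most Δ has
3N ≤ 276 + 2Δ. Choose a negative triple uvw contained in the largest number c of totally negative
4-sets. Every degree in every link graph is such a count, so Δ = c works for all of them. By parity,
n + 2c = N_uv + N_uw + N_vw, and summing three bounds gives n ≤ 276.

The bound on N plays two forces against each other. Shearer's argument for triangle-free graphs,
applied to the whole graph or to the non-neighbours of a vertex, makes small independence number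
force many edges. The form, tested on vectors constant on a vertex, on its neighbours and on the
rest, bounds the degree sum E above in terms of the sum D of the neighbours' degrees. Maximum degree
at most 4 needs only Shearer's bound; degrees 5 to 16 combine both at a vertex of maximum degree.
For larger degrees the graph is cut down to 104 vertices, and the form is also tested on the degree
vector minus a constant, range by range in E. -/

/-! ### Link graphs and the adjacency form on star and degree vectors -/

open Finset Matrix in
/-- A finite graph that is triangle-free, whose adjacency matrix `A` satisfies
`A ≤ 2 I + J / 4`, and all of whose independent sets have at most 27 elements. -/
structure IsLinkGraph {V : Type*} [Fintype V] [DecidableEq V] (G : SimpleGraph V)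
    [DecidableRel G.Adj] : Prop where
  triangleFree : ∀ x y z, G.Adj x y → G.Adj y z → ¬ G.Adj x z
  form_le : ∀ y : V → ℝ, 4 * (y ⬝ᵥ (G.adjMatrix ℝ *ᵥ y)) ≤ 8 * (y ⬝ᵥ y) + (∑ x, y x) ^ 2
  indep_card_le : ∀ s : Finset V, (∀ x ∈ s, ∀ y ∈ s, ¬ G.Adj x y) → s.card ≤ 27

/-- The sum of the degrees of the neighbours of a vertex. -/
def SimpleGraph.degreeSum₂ {V : Type*} [Fintype V] (G : SimpleGraph V) [DecidableRel G.Adj]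
    (v : V) : ℕ := ∑ w ∈ G.neighborFinset v, G.degree w

namespace SimpleGraph

variable {V : Type*} [Fintype V] (G : SimpleGraph V) [DecidableRel G.Adj]

open Finset Matrix

theorem dotProduct_adjMatrix_mulVec_comm (x y : V → ℝ) :
    x ⬝ᵥ (G.adjMatrix ℝ *ᵥ y) = y ⬝ᵥ (G.adjMatrix ℝ *ᵥ x) := by
  rw [dotProduct_mulVec, ← mulVec_transpose, G.isSymm_adjMatrix.eq, dotProduct_comm]

theorem adjMatrix_mulVec_one : G.adjMatrix ℝ *ᵥ 1 = fun v => (G.degree v : ℝ) := by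
  ext v; simp

theorem adjMatrix_mulVec_degree :
    (G.adjMatrix ℝ *ᵥ fun v => (G.degree v : ℝ)) = fun v => (G.degreeSum₂ v : ℝ) := by
  ext v; simp [degreeSum₂]

theorem sum_degreeSum₂ : ∑ v, (G.degreeSum₂ v : ℝ) = ∑ v, (G.degree v : ℝ) ^ 2 := by
  have h := G.dotProduct_adjMatrix_mulVec_comm 1 (fun v => (G.degree v : ℝ))
  rw [adjMatrix_mulVec_one, adjMatrix_mulVec_degree] at h
  simpa [dotProduct, sq] using h

theorem degreeSum₂_le {Δ : ℕ} (hΔ : ∀ v, G.degree v ≤ Δ) (v : V) :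
    G.degreeSum₂ v ≤ Δ * G.degree v := by
  unfold degreeSum₂
  calc _ ≤ ∑ w ∈ G.neighborFinset v, Δ := sum_le_sum fun w _ => hΔ w
    _ = _ := by simp [mul_comm]

theorem degree_le_degreeSum₂ (v : V) : G.degree v ≤ G.degreeSum₂ v := by
  unfold degreeSum₂
  rw [← card_neighborFinset_eq_degree, card_eq_sum_ones]
  refine sum_le_sum fun w hw => ?_
  rw [mem_neighborFinset] at hw
  exact (G.degree_pos_iff_exists_adj w).2 ⟨v, hw.symm⟩

/-- The value of the adjacency form on the vector that is `a` at `v`, `b` on the neighbours of `v`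
and `1` elsewhere. -/
theorem adjMatrix_form_star [DecidableEq V] (h : ∀ x y z, G.Adj x y → G.Adj y z → ¬ G.Adj x z) (v : V) (a b : ℝ) :
    ∃ y : V → ℝ, (∀ x, y x = if x = v then a else if G.Adj v x then b else 1) ∧
      y ⬝ᵥ y = a ^ 2 + G.degree v * b ^ 2 + (Fintype.card V - 1 - G.degree v) ∧
      ∑ x, y x = a + G.degree v * b + (Fintype.card V - 1 - G.degree v) ∧
      y ⬝ᵥ (G.adjMatrix ℝ *ᵥ y) = ∑ x, (G.degree x : ℝ) + 2 * (b - 1) * G.degreeSum₂ v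
        + 2 * (a - 1) * b * G.degree v := by
  set A := G.adjMatrix ℝ with hA
  set s : V → ℝ := Pi.single v 1 with hs
  set i : V → ℝ := 1 with hi
  set w : V → ℝ := A *ᵥ s with hw
  have hwx : ∀ x, w x = if G.Adj v x then 1 else 0 := by
    intro x
    simp [hw, hs, hA, G.adj_comm v x]
  have ii : i ⬝ᵥ i = Fintype.card V := by simp [hi, dotProduct]
  have is : i ⬝ᵥ s = 1 := by simp [hs, hi]
  have ss : s ⬝ᵥ s = 1 := by simp [hs]
  have iAi : i ⬝ᵥ (A *ᵥ i) = ∑ x, (G.degree x : ℝ) := by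
    rw [hi, hA, adjMatrix_mulVec_one]; simp [dotProduct]
  have sAi : s ⬝ᵥ (A *ᵥ i) = G.degree v := by
    rw [hi, hA, adjMatrix_mulVec_one]; simp [hs]
  have iw : i ⬝ᵥ w = G.degree v := by
    rw [hw, hA, G.dotProduct_adjMatrix_mulVec_comm, ← hA, sAi]
  have sw : s ⬝ᵥ w = 0 := by simp [hs, hwx]
  have ww : w ⬝ᵥ w = G.degree v := by
    rw [← iw]
    exact sum_congr rfl fun x _ => by rw [hwx]; split_ifs <;> simp [hi]
  have wAi : w ⬝ᵥ (A *ᵥ i) = G.degreeSum₂ v := by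
    rw [hi, hA, adjMatrix_mulVec_one]
    simp only [dotProduct, hwx, degreeSum₂, Nat.cast_sum, ite_mul, one_mul, zero_mul]
    rw [← sum_filter]
    congr 1; ext x; simp
  have sAw : s ⬝ᵥ (A *ᵥ w) = G.degree v := by
    rw [hA, G.dotProduct_adjMatrix_mulVec_comm, ← hA, ← hw, ww]
  have wAw : w ⬝ᵥ (A *ᵥ w) = 0 := by
    rw [dotProduct]
    refine sum_eq_zero fun x _ => ?_
    rw [hwx]
    split_ifs with hx
    · rw [one_mul, hA, adjMatrix_mulVec_apply]
      refine sum_eq_zero fun z hz => ?_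
      rw [mem_neighborFinset] at hz
      rw [hwx, if_neg (h v x z hx hz)]
    · simp
  have iAs : i ⬝ᵥ (A *ᵥ s) = G.degree v := iw
  have sAs : s ⬝ᵥ (A *ᵥ s) = 0 := sw
  have wAs : w ⬝ᵥ (A *ᵥ s) = G.degree v := ww
  have iAw : i ⬝ᵥ (A *ᵥ w) = G.degreeSum₂ v := by
    rw [hA, G.dotProduct_adjMatrix_mulVec_comm, ← hA, wAi]
  have si : s ⬝ᵥ i = 1 := by rw [dotProduct_comm, is]
  have wi : w ⬝ᵥ i = G.degree v := by rw [dotProduct_comm, iw]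
  have ws : w ⬝ᵥ s = 0 := by rw [dotProduct_comm, sw]
  refine ⟨i + (a - 1) • s + (b - 1) • w, fun x => ?_, ?_, ?_, ?_⟩
  · have hx : s x = if x = v then 1 else 0 := by simp [hs, Pi.single_apply]
    simp only [Pi.add_apply, Pi.smul_apply, hwx, hx, hi, Pi.one_apply, smul_eq_mul]
    by_cases hxv : x = v
    · subst hxv; simp
    · simp only [hxv, if_false]; split_ifs <;> ring
  · simp only [add_dotProduct, dotProduct_add, smul_dotProduct, dotProduct_smul, ii, is, ss, iw, sw,
      ww, si, wi, ws, smul_eq_mul]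
    ring
  · have : ∑ x, (i + (a - 1) • s + (b - 1) • w) x = i ⬝ᵥ (i + (a - 1) • s + (b - 1) • w) :=
      (one_dotProduct _).symm
    rw [this]
    simp only [dotProduct_add, dotProduct_smul, ii, is, iw, smul_eq_mul]
    ring
  · simp only [add_dotProduct, dotProduct_add, smul_dotProduct, dotProduct_smul, mulVec_add,
      mulVec_smul, iAi, iAs, iAw, sAi, sAs, sAw, wAi, wAs, wAw, smul_eq_mul]
    ring

end SimpleGraph

namespace IsLinkGraph

variable {V : Type*} [Fintype V] [DecidableEq V] {G : SimpleGraph V} [DecidableRel G.Adj]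

open Finset Matrix SimpleGraph

theorem star_le (h : IsLinkGraph G) (v : V) (a b : ℝ) :
    4 * (∑ x, (G.degree x : ℝ) + 2 * (b - 1) * G.degreeSum₂ v + 2 * (a - 1) * b * G.degree v) ≤
      8 * (a ^ 2 + G.degree v * b ^ 2 + (Fintype.card V - 1 - G.degree v)) +
      (a + G.degree v * b + (Fintype.card V - 1 - G.degree v)) ^ 2 := by
  obtain ⟨y, -, h1, h2, h3⟩ := G.adjMatrix_form_star h.triangleFree v a b
  rw [← h1, ← h2, ← h3]
  exact h.form_le y

/-- This is the form inequality at the test vector d - μ·1, where d is the degree vector. -/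
theorem degree_form_le (h : IsLinkGraph G) (μ : ℝ) :
    4 * (∑ v, (G.degree v : ℝ) * G.degreeSum₂ v - 2 * μ * ∑ v, (G.degree v : ℝ) ^ 2
        + μ ^ 2 * ∑ v, (G.degree v : ℝ)) ≤
      8 * (∑ v, (G.degree v : ℝ) ^ 2 - 2 * μ * ∑ v, (G.degree v : ℝ) + μ ^ 2 * Fintype.card V) +
      (∑ v, (G.degree v : ℝ) - μ * Fintype.card V) ^ 2 := by
  set d : V → ℝ := fun v => (G.degree v : ℝ) with hd
  set i : V → ℝ := 1 with hi
  have ii : i ⬝ᵥ i = Fintype.card V := by simp [hi, dotProduct]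
  have id : i ⬝ᵥ d = ∑ v, (G.degree v : ℝ) := by simp [hi, hd, dotProduct]
  have di : d ⬝ᵥ i = ∑ v, (G.degree v : ℝ) := by simp [hi, hd, dotProduct]
  have dd : d ⬝ᵥ d = ∑ v, (G.degree v : ℝ) ^ 2 := by simp [hd, dotProduct, sq]
  have Ai : G.adjMatrix ℝ *ᵥ i = d := G.adjMatrix_mulVec_one
  have iAd : i ⬝ᵥ (G.adjMatrix ℝ *ᵥ d) = ∑ v, (G.degree v : ℝ) ^ 2 := by
    rw [G.dotProduct_adjMatrix_mulVec_comm, Ai, dd]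
  have dAd : d ⬝ᵥ (G.adjMatrix ℝ *ᵥ d) = ∑ v, (G.degree v : ℝ) * G.degreeSum₂ v := by
    rw [hd, G.adjMatrix_mulVec_degree, dotProduct]
  have key := h.form_le (d - μ • i)
  have hs : ∑ x, (d - μ • i) x = i ⬝ᵥ (d - μ • i) := (one_dotProduct _).symm
  rw [hs] at key
  simp only [sub_dotProduct, dotProduct_sub, smul_dotProduct, dotProduct_smul, mulVec_sub,
    mulVec_smul, smul_eq_mul, Ai, ii, id, di, dd, iAd, dAd] at key
  linarith

end IsLinkGraph

/-! ### Shearer's bound for independent sets in triangle-free graphs -/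

/-- A convex decreasing lower bound for the contribution of a vertex of given degree to the
independence number of a triangle-free graph. -/
noncomputable def indepWeight : ℕ → ℝ
  | 0 => 1
  | 1 => 1 / 2
  | 2 => 2 / 5
  | n + 3 => 17 / 50 - 7 / 170 * n

theorem indepWeight_sub_antitone : Antitone fun n => indepWeight n - indepWeight (n + 1) := by
  refine antitone_nat_of_succ_le fun n => ?_
  match n with
  | 0 => norm_num [indepWeight]
  | 1 => norm_num [indepWeight]
  | 2 => norm_num [indepWeight]
  | n + 3 => simp only [indepWeight]; push_cast; linarith

theorem indepWeight_pred_sub_anti {a b : ℕ} (ha : 1 ≤ a) (hab : a ≤ b) :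
    indepWeight (b - 1) - indepWeight b ≤ indepWeight (a - 1) - indepWeight a := by
  obtain ⟨a, rfl⟩ := Nat.exists_eq_add_of_le' ha
  obtain ⟨b, rfl⟩ := Nat.exists_eq_add_of_le' (ha.trans hab)
  exact indepWeight_sub_antitone (by omega : a ≤ b)

theorem indepWeight_sub_ge (d k : ℕ) (hk : k ≤ d) :
    indepWeight d + k * (indepWeight (d - 1) - indepWeight d) ≤ indepWeight (d - k) := by
  induction k with
  | zero => simp
  | succ k ih =>
    have h1 := ih (by omega)
    have h2 := indepWeight_pred_sub_anti (a := d - k) (b := d) (by omega) (by omega)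
    rw [show d - (k + 1) = d - k - 1 by omega]
    push_cast
    linarith

/-- Shearer's recursion (d² + 1) f(d) = 1 + d(d - 1) f(d - 1) holds with equality for d ≤ 4. Beyond
that the weight continues with the slope from 3 to 4, which keeps it convex and leaves only the
inequality. -/
theorem indepWeight_recursion (d : ℕ) :
    0 ≤ 1 - (1 + d) * indepWeight d + d * (d - 1) * (indepWeight (d - 1) - indepWeight d) := by
  match d with
  | 0 => norm_num [indepWeight]
  | 1 => norm_num [indepWeight]
  | 2 => norm_num [indepWeight]
  | 3 => norm_num [indepWeight]
  | n + 4 =>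
    simp only [indepWeight, show n + 4 - 1 = n + 3 from rfl]
    push_cast
    have : (0 : ℝ) ≤ n := n.cast_nonneg
    nlinarith

theorem le_indepWeight (d : ℕ) : (17 / 50 - 7 / 170 * (d - 3) : ℝ) ≤ indepWeight d := by
  match d with
  | 0 => norm_num [indepWeight]
  | 1 => norm_num [indepWeight]
  | 2 => norm_num [indepWeight]
  | n + 3 => simp only [indepWeight]; push_cast; linarith

namespace SimpleGraph

variable {V : Type*} [DecidableEq V] (G : SimpleGraph V) [DecidableRel G.Adj]

open Finset

/-- Averaging over v. Deleting the closed neighbourhood of v lowers the degree of a surviving u by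
its number of common neighbours with v, and convexity bounds the resulting gain in weight from
below. Summed over v, the change in total weight plus 1 per vertex is nonnegative by
`indepWeight_recursion`, so some v works. -/
theorem exists_removal_indepWeight (h : ∀ x y z, G.Adj x y → G.Adj y z → ¬ G.Adj x z)
    (U : Finset V) (hU : U.Nonempty) : ∃ v ∈ U,
      ∑ u ∈ U, indepWeight #{w ∈ U | G.Adj u w} ≤ 1 + ∑ u ∈ U with u ≠ v ∧ ¬ G.Adj v u,
        indepWeight #{w ∈ {w ∈ U | w ≠ v ∧ ¬ G.Adj v w} | G.Adj u w} := by
  set d : V → ℕ := fun u => #{w ∈ U | G.Adj u w} with hd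
  set f := indepWeight
  set δ : V → ℝ := fun u => f (d u - 1) - f (d u) with hδ
  set a : V → V → ℝ := fun x y => if G.Adj x y then 1 else 0 with ha
  set ν : V → V → ℝ := fun v u => if u ≠ v ∧ ¬ G.Adj v u then 1 else 0 with hν
  have asymm : ∀ x y, a x y = a y x := fun x y => by simp only [ha, G.adj_comm]
  have da : ∀ u, (d u : ℝ) = ∑ w ∈ U, a u w := fun u => by simp [hd, ha]
  -- degrees after the removal of the closed neighbourhood of `v`
  have step : ∀ v ∈ U, ∑ u ∈ U, ν v u * (f (d u) + (∑ w ∈ U, a u w * a v w) * δ u) ≤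
      ∑ u ∈ U with u ≠ v ∧ ¬ G.Adj v u,
        f #{w ∈ {w ∈ U | w ≠ v ∧ ¬ G.Adj v w} | G.Adj u w} := by
    intro v _
    rw [sum_filter]
    refine sum_le_sum fun u _ => ?_
    by_cases hu : u ≠ v ∧ ¬ G.Adj v u
    · simp only [hν, if_pos hu, one_mul]
      have hk : (∑ w ∈ U, a u w * a v w) = (#{w ∈ U | G.Adj u w ∧ G.Adj v w} : ℝ) := by
        rw [card_filter]
        push_cast
        refine sum_congr rfl fun w _ => ?_
        by_cases h1 : G.Adj u w <;> by_cases h2 : G.Adj v w <;> simp [ha, h1, h2]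
      have hsplit : #{w ∈ {w ∈ U | w ≠ v ∧ ¬ G.Adj v w} | G.Adj u w} =
          d u - #{w ∈ U | G.Adj u w ∧ G.Adj v w} := by
        have h1 := card_filter_add_card_filter_not (s := {w ∈ U | G.Adj u w}) (fun w => G.Adj v w)
        rw [filter_filter, filter_filter] at h1
        have h2 : ({w ∈ {w ∈ U | w ≠ v ∧ ¬ G.Adj v w} | G.Adj u w} : Finset V) =
            {w ∈ U | G.Adj u w ∧ ¬ G.Adj v w} := by
          ext w
          simp only [mem_filter]
          constructor
          · tauto
          · rintro ⟨h1, h2, h3⟩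
            exact ⟨⟨h1, fun hw => hu.2 (hw ▸ h2.symm), h3⟩, h2⟩
        rw [h2]
        simp only [hd]
        omega
      rw [hk, hsplit]
      refine indepWeight_sub_ge _ _ (card_le_card fun w hw => ?_)
      simp only [mem_filter] at hw ⊢
      exact ⟨hw.1, hw.2.1⟩
    · simp [hν, if_neg hu]
  have hνsum : ∀ v ∈ U, ∀ g : V → ℝ, ∑ u ∈ U, ν v u * g u =
      ∑ u ∈ U, g u - g v - ∑ u ∈ U, a v u * g u := by
    intro v hv g
    have h1 : ∀ u, ν v u = 1 - (if u = v then 1 else 0) - a v u := by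
      intro u
      by_cases huv : u = v
      · subst huv; simp [hν, ha]
      · by_cases hadj : G.Adj v u <;> simp [hν, ha, huv, hadj]
    simp only [h1, sub_mul, sum_sub_distrib, one_mul, ite_mul, zero_mul, sum_ite_eq', if_pos hv]
  -- Count paths u, w, v with v ≠ u: triangle-freeness makes v automatically non-adjacent to u.
  have hwalk : ∀ u ∈ U, ∑ v ∈ U, ν v u * ∑ w ∈ U, a u w * a v w = ∑ w ∈ U, a u w * (d w - 1) := by
    intro u hu
    simp only [mul_sum]
    rw [sum_comm]
    refine sum_congr rfl fun w _ => ?_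
    by_cases huw : G.Adj u w
    · have h1 : ∀ v, ν v u * (a u w * a v w) = a w v - if v = u then 1 else 0 := by
        intro v
        by_cases hvu : v = u
        · subst hvu; simp [hν, ha, huw.symm]
        · by_cases hvw : G.Adj v w
          · have : ¬ G.Adj v u := fun h' => h v u w h' huw hvw
            simp [hν, ha, Ne.symm hvu, hvu, this, huw, hvw, hvw.symm]
          · have : ¬ G.Adj w v := fun h' => hvw h'.symm
            simp [ha, hvw, hvu, this]
      simp only [h1, sum_sub_distrib, sum_ite_eq', if_pos hu, da]
      simp [ha, huw]
    · simp [ha, huw]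
  -- A Chebyshev-type exchange along edges: δ decreases with the degree, so (δ u - δ w)(d w - d u) ≥
  -- 0.
  have hchange : ∑ u ∈ U, (d u : ℝ) * (d u - 1) * δ u ≤
      ∑ u ∈ U, δ u * ∑ w ∈ U, a u w * (d w - 1) := by
    have h1 : ∑ u ∈ U, (d u : ℝ) * (d u - 1) * δ u = ∑ u ∈ U, ∑ w ∈ U, a u w * (δ u * (d u - 1)) := by
      refine sum_congr rfl fun u _ => ?_
      rw [← sum_mul, ← da]; ring
    have h2 : ∑ u ∈ U, δ u * ∑ w ∈ U, a u w * (d w - 1) =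
        ∑ u ∈ U, ∑ w ∈ U, a u w * (δ u * (d w - 1)) := by
      refine sum_congr rfl fun u _ => ?_
      rw [mul_sum]
      exact sum_congr rfl fun w _ => by ring
    have h3 : ∑ u ∈ U, ∑ w ∈ U, a u w * (δ u * (d u - 1)) =
        ∑ u ∈ U, ∑ w ∈ U, a u w * (δ w * (d w - 1)) := by
      rw [sum_comm]
      exact sum_congr rfl fun u _ => sum_congr rfl fun w _ => by rw [asymm]
    have h4 : ∑ u ∈ U, ∑ w ∈ U, a u w * (δ u * (d w - 1)) =
        ∑ u ∈ U, ∑ w ∈ U, a u w * (δ w * (d u - 1)) := by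
      rw [sum_comm]
      exact sum_congr rfl fun u _ => sum_congr rfl fun w _ => by rw [asymm]
    have h5 : 0 ≤ ∑ u ∈ U, ∑ w ∈ U, a u w * ((δ u - δ w) * ((d w : ℝ) - d u)) := by
      refine sum_nonneg fun u hu => sum_nonneg fun w hw => ?_
      by_cases huw : G.Adj u w
      · have pu : 1 ≤ d u := card_pos.2 ⟨w, by simp [hw, huw]⟩
        have pw : 1 ≤ d w := card_pos.2 ⟨u, by simp [hu, huw.symm]⟩
        simp only [ha, if_pos huw, one_mul]
        rcases le_total (d u) (d w) with hle | hle
        · exact mul_nonneg (sub_nonneg.2 (indepWeight_pred_sub_anti pu hle))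
            (sub_nonneg.2 (by exact_mod_cast hle))
        · exact mul_nonneg_of_nonpos_of_nonpos (sub_nonpos.2 (indepWeight_pred_sub_anti pw hle))
            (sub_nonpos.2 (by exact_mod_cast hle))
      · simp [ha, huw]
    have h6 : ∑ u ∈ U, ∑ w ∈ U, a u w * ((δ u - δ w) * ((d w : ℝ) - d u)) =
        ∑ u ∈ U, ∑ w ∈ U, a u w * (δ u * (d w - 1)) - ∑ u ∈ U, ∑ w ∈ U, a u w * (δ u * (d u - 1))
        + ∑ u ∈ U, ∑ w ∈ U, a u w * (δ w * (d u - 1))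
        - ∑ u ∈ U, ∑ w ∈ U, a u w * (δ w * (d w - 1)) := by
      simp only [← sum_sub_distrib, ← sum_add_distrib]
      exact sum_congr rfl fun u _ => sum_congr rfl fun w _ => by ring
    linarith
  by_contra! hcon
  have hlt := sum_lt_sum_of_nonempty hU fun v hv => hcon v hv
  have hge : ∑ v ∈ U, ∑ u ∈ U, f (d u) ≤ ∑ v ∈ U, (1 + ∑ u ∈ U with u ≠ v ∧ ¬ G.Adj v u,
        f #{w ∈ {w ∈ U | w ≠ v ∧ ¬ G.Adj v w} | G.Adj u w}) := by
    calc ∑ v ∈ U, ∑ u ∈ U, f (d u)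
        ≤ ∑ v ∈ U, ∑ u ∈ U, f (d u) + ∑ u ∈ U, (1 - (1 + d u) * f (d u)
            + d u * (d u - 1) * (f (d u - 1) - f (d u))) :=
          le_add_of_nonneg_right (sum_nonneg fun u _ => indepWeight_recursion (d u))
      _ ≤ ∑ v ∈ U, (1 + (∑ u ∈ U, f (d u) - f (d v) - ∑ u ∈ U, a v u * f (d u)))
            + ∑ u ∈ U, δ u * ∑ w ∈ U, a u w * (d w - 1) := by
          have h1 : ∑ v ∈ U, ∑ u ∈ U, a v u * f (d u) = ∑ u ∈ U, d u * f (d u) := by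
            rw [sum_comm]
            refine sum_congr rfl fun u _ => ?_
            rw [← sum_mul, da]
            simp only [asymm u]
          have h2 : ∑ u ∈ U, (1 - (1 + d u) * f (d u) + d u * (d u - 1) * (f (d u - 1) - f (d u))) =
              ∑ u ∈ U, (1 : ℝ) - ∑ u ∈ U, f (d u) - ∑ u ∈ U, d u * f (d u)
              + ∑ u ∈ U, (d u : ℝ) * (d u - 1) * δ u := by
            simp only [← sum_sub_distrib, ← sum_add_distrib]
            exact sum_congr rfl fun u _ => by ring
          rw [h2]
          simp only [sum_add_distrib, sum_sub_distrib, h1]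
          linarith
      _ = ∑ v ∈ U, (1 + ∑ u ∈ U, ν v u * (f (d u) + (∑ w ∈ U, a u w * a v w) * δ u)) := by
          have h1 : ∑ v ∈ U, ∑ u ∈ U, ν v u * ((∑ w ∈ U, a u w * a v w) * δ u) =
              ∑ u ∈ U, δ u * ∑ w ∈ U, a u w * (d w - 1) := by
            rw [sum_comm]
            refine sum_congr rfl fun u hu => ?_
            rw [← hwalk u hu, mul_sum]
            exact sum_congr rfl fun v _ => by ring
          rw [← h1, ← sum_add_distrib]
          refine sum_congr rfl fun v hv => ?_
          simp only [mul_add, sum_add_distrib]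
          linarith [hνsum v hv fun u => f (d u)]
      _ ≤ _ := sum_le_sum fun v hv => by linarith [step v hv]
  exact absurd hge (not_le.2 hlt)

theorem exists_indep_sum_indepWeight_le (h : ∀ x y z, G.Adj x y → G.Adj y z → ¬ G.Adj x z)
    (U : Finset V) : ∃ I ⊆ U, (∀ x ∈ I, ∀ y ∈ I, ¬ G.Adj x y) ∧
      ∑ u ∈ U, indepWeight #{w ∈ U | G.Adj u w} ≤ #I := by
  induction U using Finset.strongInduction with
  | H U ih =>
    rcases U.eq_empty_or_nonempty with rfl | hU
    · exact ⟨∅, by simp⟩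
    · obtain ⟨v, hv, hle⟩ := G.exists_removal_indepWeight h U hU
      obtain ⟨I, hIU, hI, hIle⟩ := ih {w ∈ U | w ≠ v ∧ ¬ G.Adj v w}
        ((filter_ssubset).2 ⟨v, hv, by simp⟩)
      have hvI : v ∉ I := fun hvI => by simpa using hIU hvI
      have hnadj : ∀ x ∈ I, ¬ G.Adj v x := fun x hx => (mem_filter.1 (hIU hx)).2.2
      refine ⟨insert v I, insert_subset hv (hIU.trans (filter_subset _ _)), ?_, ?_⟩
      · intro x hx y hy
        rcases mem_insert.1 hx with hx' | hx' <;> rcases mem_insert.1 hy with hy' | hy'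
        · rw [hx', hy']; exact G.irrefl
        · rw [hx']; exact hnadj y hy'
        · rw [hy']; exact fun h' => hnadj x hx' h'.symm
        · exact hI x hx' y hy'
      · rw [card_insert_of_notMem hvI]
        push_cast
        linarith

end SimpleGraph

/-! ### Excluding ranges of the degree sum on 104 vertices -/

/-- A range of degree sums `E` on which the star inequality at a vertex of degree `c` with
neighbour degree sum `D`, in a graph with 104 vertices, is incompatible with the averaged form of
the degree inequality with multipliers `μ`, `ν`, `η`. -/
def DegreeSumCell (Δ : ℕ) (μ ν η s E₁ E₂ : ℝ) : Prop :=
  ∀ c : ℕ, c ≤ Δ → ∀ E D a b : ℝ, b = -(s * (4 + 54 / (c + 1))) → a = (3 * c * b - (103 - c)) / 9 →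
    E ^ 2 ≤ (E₁ + E₂) * E - E₁ * E₂ → E₁ ≤ E → E ≤ E₂ → c ≤ D → D ≤ Δ * c →
    4 * (E + 2 * (b - 1) * D + 2 * (a - 1) * b * c) ≤
      8 * (a ^ 2 + c * b ^ 2 + (103 - c)) + (a + c * b + (103 - c)) ^ 2 →
    8 * (c - μ) ^ 2 + (E - 104 * μ) ^ 2 / 104 + 8 * μ * c ^ 2 - 4 * μ ^ 2 * c - 4 * c * D
      + ν * (D - c ^ 2) - η * (c - E / 104) < 0

/-- In each cell, a minimizes the slack of the star inequality for the given b; any b is legitimate,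
so its formula need only be good enough. Since b < 0, the star inequality bounds D below in terms of
E. Replacing E² by its chord over the range makes everything linear in E and D once c is fixed, so
each c is a small linear program. -/
theorem degreeSumCell_515 : DegreeSumCell 25 5 0 (-166) (21 / 20) 515 675 := by
  intro c hc E D a b hb ha h1 h2 h3 h4 h5 h6
  interval_cases c <;> norm_num at hb <;> rw [hb] at ha <;> norm_num at ha <;>
    rw [ha, hb] at h6 <;> norm_num at h4 h5 h6 ⊢ <;> linarith

theorem degreeSumCell_675 : DegreeSumCell 25 (13 / 2) 0 (-272) (21 / 20) 675 955 := by
  intro c hc E D a b hb ha h1 h2 h3 h4 h5 h6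
  interval_cases c <;> norm_num at hb <;> rw [hb] at ha <;> norm_num at ha <;>
    rw [ha, hb] at h6 <;> norm_num at h4 h5 h6 ⊢ <;> linarith

theorem degreeSumCell_955 : DegreeSumCell 25 (17 / 2) 8 (-266) (17 / 20) 955 1215 := by
  intro c hc E D a b hb ha h1 h2 h3 h4 h5 h6
  interval_cases c <;> norm_num at hb <;> rw [hb] at ha <;> norm_num at ha <;>
    rw [ha, hb] at h6 <;> norm_num at h4 h5 h6 ⊢ <;> linarith

theorem degreeSumCell_1215 : DegreeSumCell 25 11 32 (-292) (17 / 20) 1215 1457 := by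
  intro c hc E D a b hb ha h1 h2 h3 h4 h5 h6
  interval_cases c <;> norm_num at hb <;> rw [hb] at ha <;> norm_num at ha <;>
    rw [ha, hb] at h6 <;> norm_num at h4 h5 h6 ⊢ <;> linarith

theorem degreeSumCell_1456 : DegreeSumCell 22 13 40 (-262) (3 / 4) 1456 1716 := by
  intro c hc E D a b hb ha h1 h2 h3 h4 h5 h6
  interval_cases c <;> norm_num at hb <;> rw [hb] at ha <;> norm_num at ha <;>
    rw [ha, hb] at h6 <;> norm_num at h4 h5 h6 ⊢ <;> linarith

theorem degreeSumCell_1716 : DegreeSumCell 22 (31 / 2) 48 (-170) (13 / 20) 1716 1916 := by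
  intro c hc E D a b hb ha h1 h2 h3 h4 h5 h6
  interval_cases c <;> norm_num at hb <;> rw [hb] at ha <;> norm_num at ha <;>
    rw [ha, hb] at h6 <;> norm_num at h4 h5 h6 ⊢ <;> linarith

theorem degreeSumCell_1916 : DegreeSumCell 22 (35 / 2) 64 (-187) (3 / 5) 1916 2096 := by
  intro c hc E D a b hb ha h1 h2 h3 h4 h5 h6
  interval_cases c <;> norm_num at hb <;> rw [hb] at ha <;> norm_num at ha <;>
    rw [ha, hb] at h6 <;> norm_num at h4 h5 h6 ⊢ <;> linarith

theorem degreeSumCell_2096 : DegreeSumCell 22 19 72 (-181) (1 / 2) 2096 2288 := by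
  intro c hc E D a b hb ha h1 h2 h3 h4 h5 h6
  interval_cases c <;> norm_num at hb <;> rw [hb] at ha <;> norm_num at ha <;>
    rw [ha, hb] at h6 <;> norm_num at h4 h5 h6 ⊢ <;> linarith

namespace IsLinkGraph

variable {V : Type*} [Fintype V] [DecidableEq V] {G : SimpleGraph V} [DecidableRel G.Adj]

open Finset SimpleGraph

/-- Summed over v the expression is nonnegative by `degree_form_le`. The multipliers ν and η attach
to quantities of total zero: `sum_degreeSum₂` and the deviation from the mean degree. -/
theorem exists_degree_ineq [Nonempty V] (h : IsLinkGraph G) (μ ν η : ℝ) : ∃ v,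
    0 ≤ 8 * (G.degree v - μ) ^ 2
      + (∑ x, (G.degree x : ℝ) - Fintype.card V * μ) ^ 2 / Fintype.card V
      + 8 * μ * G.degree v ^ 2 - 4 * μ ^ 2 * G.degree v - 4 * G.degree v * G.degreeSum₂ v
      + ν * (G.degreeSum₂ v - G.degree v ^ 2)
      - η * (G.degree v - (∑ x, (G.degree x : ℝ)) / Fintype.card V) := by
  by_contra! hcon
  have hN : (Fintype.card V : ℝ) ≠ 0 := Nat.cast_ne_zero.2 Fintype.card_ne_zero
  have hsum := sum_lt_sum_of_nonempty univ_nonempty fun v (_ : v ∈ univ) => hcon v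
  have hform := h.degree_form_le μ
  have hD := G.sum_degreeSum₂
  have e1 : ∑ v, (8 * ((G.degree v : ℝ) - μ) ^ 2) =
      8 * (∑ v, (G.degree v : ℝ) ^ 2 - 2 * μ * ∑ v, (G.degree v : ℝ)
        + μ ^ 2 * Fintype.card V) := by
    simp only [sub_sq, mul_add, mul_sub, sum_add_distrib, sum_sub_distrib, mul_sum, sum_const,
      card_univ, nsmul_eq_mul]
    congr 1
    · congr 1
      exact sum_congr rfl fun v _ => by ring
    · ring
  have e2 : ∑ v, (4 * (G.degree v : ℝ) * G.degreeSum₂ v) =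
      4 * ∑ v, (G.degree v : ℝ) * G.degreeSum₂ v := by
    simp only [mul_sum, mul_assoc]
  simp only [sum_add_distrib, sum_sub_distrib, ← mul_sum, e1, e2, sum_const, card_univ,
    nsmul_eq_mul, hD, mul_zero] at hsum
  have e3 : (Fintype.card V : ℝ) * ((∑ x, (G.degree x : ℝ) - Fintype.card V * μ) ^ 2 /
      Fintype.card V) = (∑ x, (G.degree x : ℝ) - Fintype.card V * μ) ^ 2 := by field_simp
  have e4 : (Fintype.card V : ℝ) * ((∑ x, (G.degree x : ℝ)) / Fintype.card V) =
    ∑ x, (G.degree x : ℝ) := by field_simp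
  rw [e3, e4] at hsum
  nlinarith

theorem false_of_cell (h : IsLinkGraph G) (hN : Fintype.card V = 104) {Δ : ℕ}
    (hΔ : ∀ v, G.degree v ≤ Δ) {μ ν η s E₁ E₂ : ℝ} (hc : DegreeSumCell Δ μ ν η s E₁ E₂)
    (h₁ : E₁ ≤ ∑ v, (G.degree v : ℝ)) (h₂ : ∑ v, (G.degree v : ℝ) ≤ E₂) : False := by
  have : Nonempty V := Fintype.card_pos_iff.1 (by omega)
  obtain ⟨v, hv⟩ := h.exists_degree_ineq μ ν η
  have hs := h.star_le v ((3 * G.degree v * -(s * (4 + 54 / (G.degree v + 1)))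
    - (103 - G.degree v)) / 9) (-(s * (4 + 54 / (G.degree v + 1))))
  rw [hN] at hv hs
  have := hc (G.degree v) (hΔ v) (∑ v, (G.degree v : ℝ)) (G.degreeSum₂ v) _ _ rfl rfl
    (by nlinarith) h₁ h₂ (by exact_mod_cast G.degree_le_degreeSum₂ v)
    (by exact_mod_cast G.degreeSum₂_le hΔ v) (by norm_num at hs ⊢; linarith)
  norm_num at hv
  linarith

end IsLinkGraph

/-! ### Bounds on degree sums and common neighbours -/

namespace IsLinkGraph

open Finset Matrix SimpleGraph

section

variable {V : Type*} [Fintype V] [DecidableEq V] {G : SimpleGraph V} [DecidableRel G.Adj]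

theorem comap {W : Type*} [Fintype W] [DecidableEq W] (h : IsLinkGraph G) (f : W ↪ V) :
    IsLinkGraph (G.comap f) where
  triangleFree x y z := h.triangleFree (f x) (f y) (f z)
  form_le y := by
    set y' : V → ℝ := Function.extend f y (fun _ => 0) with hy'
    have e : ∀ w, y' (f w) = y w := fun w => f.injective.extend_apply y _ w
    have e0 : ∀ x ∉ Set.range f, y' x = 0 := fun x hx =>
      Function.extend_apply' y _ x fun ⟨w, hw⟩ => hx ⟨w, hw⟩
    have h1 : y ⬝ᵥ y = y' ⬝ᵥ y' :=
      Fintype.sum_of_injective f f.injective _ _ (fun x hx => by rw [e0 x hx, zero_mul])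
        fun w => by rw [e]
    have h2 : ∑ w, y w = ∑ x, y' x :=
      Fintype.sum_of_injective f f.injective _ _ (fun x hx => e0 x hx) fun w => (e w).symm
    have h3 : y ⬝ᵥ ((G.comap f).adjMatrix ℝ *ᵥ y) = y' ⬝ᵥ (G.adjMatrix ℝ *ᵥ y') := by
      refine Fintype.sum_of_injective f f.injective _ _
        (fun x hx => by rw [e0 x hx, zero_mul]) fun w => ?_
      rw [e]
      congr 1
      refine Fintype.sum_of_injective f f.injective _ _
        (fun x hx => by rw [e0 x hx, mul_zero]) fun z => ?_
      rw [e]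
      simp [adjMatrix_apply]
    rw [h1, h2, h3]
    exact h.form_le y'
  indep_card_le s hs := by
    rw [← card_map f]
    refine h.indep_card_le _ fun x hx y hy => ?_
    obtain ⟨x', hx', rfl⟩ := mem_map.1 hx
    obtain ⟨y', hy', rfl⟩ := mem_map.1 hy
    exact hs x' hx' y' hy'

theorem degree_le_27 (h : IsLinkGraph G) (v : V) : G.degree v ≤ 27 := by
  rw [← card_neighborFinset_eq_degree]
  refine h.indep_card_le _ fun x hx y hy hxy => ?_
  rw [mem_neighborFinset] at hx hy
  exact h.triangleFree v x y hx hxy hy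

theorem sum_degree_ge (h : IsLinkGraph G) :
    17 / 50 * (Fintype.card V : ℝ) - 7 / 170 * (∑ v, (G.degree v : ℝ) - 3 * Fintype.card V) ≤ 27 := by
  obtain ⟨I, -, hI, hle⟩ := G.exists_indep_sum_indepWeight_le h.triangleFree univ
  have h1 : (#I : ℝ) ≤ 27 := by exact_mod_cast h.indep_card_le I hI
  have h2 : ∑ v, (17 / 50 - 7 / 170 * ((G.degree v : ℝ) - 3)) ≤
      ∑ u, indepWeight #{w | G.Adj u w} := by
    refine sum_le_sum fun v _ => ?_
    have := le_indepWeight #{w | G.Adj v w}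
    rwa [← neighborFinset_eq_filter, card_neighborFinset_eq_degree] at this ⊢
  simp only [sum_sub_distrib, ← mul_sum, sum_const, card_univ, nsmul_eq_mul] at h2
  linarith

theorem card_antineighbors (G : SimpleGraph V) [DecidableRel G.Adj] (v : V) :
    (#{x | x ≠ v ∧ ¬ G.Adj v x} : ℝ) = Fintype.card V - 1 - G.degree v := by
  have h1 : #{x | x ≠ v ∧ ¬ G.Adj v x} + #(insert v (G.neighborFinset v)) = Fintype.card V := by
    rw [← card_univ, ← card_filter_add_card_filter_not (s := univ) (fun x => x ≠ v ∧ ¬ G.Adj v x)]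
    congr 2
    ext x; simp [or_iff_not_imp_left]
  rw [card_insert_of_notMem (by simp), card_neighborFinset_eq_degree] at h1
  rw [← h1]
  push_cast
  ring

theorem sum_degree_antineighbors (h : IsLinkGraph G) (v : V) :
    ∑ u with u ≠ v ∧ ¬ G.Adj v u, (#{w ∈ {x | x ≠ v ∧ ¬ G.Adj v x} | G.Adj u w} : ℝ) =
      ∑ x, (G.degree x : ℝ) - 2 * G.degreeSum₂ v := by
  obtain ⟨y, hy, -, -, h3⟩ := G.adjMatrix_form_star h.triangleFree v 0 0
  have hy' : ∀ x, y x = if x ≠ v ∧ ¬ G.Adj v x then 1 else 0 := by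
    intro x
    rw [hy]
    by_cases h1 : x = v <;> by_cases h2 : G.Adj v x <;> simp [h1, h2]
  have : ∑ u with u ≠ v ∧ ¬ G.Adj v u, (#{w ∈ {x | x ≠ v ∧ ¬ G.Adj v x} | G.Adj u w} : ℝ) =
      y ⬝ᵥ (G.adjMatrix ℝ *ᵥ y) := by
    rw [sum_filter, dotProduct]
    refine sum_congr rfl fun u _ => ?_
    rw [hy' u]
    split_ifs with hu
    · rw [one_mul, adjMatrix_mulVec_apply, neighborFinset_eq_filter, sum_filter, card_filter,
        sum_filter]
      push_cast
      refine sum_congr rfl fun w _ => ?_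
      rw [hy' w]
      split_ifs <;> rfl
    · rw [zero_mul]
  rw [this, h3]
  ring

/-- Shearer's bound among the non-neighbours of v, where an independent set has at most 26 elements
because v can be added to it. -/
theorem sum_degree_antineighbors_ge (h : IsLinkGraph G) (v : V) :
    17 / 50 * (Fintype.card V - 1 - G.degree v : ℝ) - 7 / 170 * (∑ x, (G.degree x : ℝ)
      - 2 * G.degreeSum₂ v - 3 * (Fintype.card V - 1 - G.degree v)) ≤ 26 := by
  obtain ⟨I, hIT, hI, hle⟩ :=
    G.exists_indep_sum_indepWeight_le h.triangleFree {x | x ≠ v ∧ ¬ G.Adj v x}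
  have hvI : v ∉ I := fun hv => by simpa using hIT hv
  have hnadj : ∀ x ∈ I, ¬ G.Adj v x := fun x hx => (mem_filter.1 (hIT hx)).2.2
  have h0 : #(insert v I) ≤ 27 := by
    refine h.indep_card_le _ fun x hx y hy => ?_
    rcases mem_insert.1 hx with hx' | hx' <;> rcases mem_insert.1 hy with hy' | hy'
    · rw [hx', hy']; exact G.irrefl
    · rw [hx']; exact hnadj y hy'
    · rw [hy']; exact fun h' => hnadj x hx' h'.symm
    · exact hI x hx' y hy'
  rw [card_insert_of_notMem hvI] at h0
  have h1 : (#I : ℝ) ≤ 26 := by exact_mod_cast (by omega : #I ≤ 26)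
  have h2 := sum_le_sum fun u (_ : u ∈ ({x | x ≠ v ∧ ¬ G.Adj v x} : Finset V)) =>
    le_indepWeight #{w ∈ {x | x ≠ v ∧ ¬ G.Adj v x} | G.Adj u w}
  simp only [sum_sub_distrib, ← mul_sum, sum_const, nsmul_eq_mul, h.sum_degree_antineighbors v,
    card_antineighbors] at h2
  linarith

theorem degree_add_three_mul_card_common_le (h : IsLinkGraph G) {v u : V} (huv : u ≠ v)
    (hadj : ¬ G.Adj v u) :
    G.degree v + 3 * #{w ∈ G.neighborFinset v | G.Adj u w} ≤ 40 := by
  set A := G.adjMatrix ℝ with hA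
  set s : V → ℝ := Pi.single v 1 with hs
  set r : V → ℝ := Pi.single u 1 with hr
  set n : V → ℝ := fun x => if G.Adj v x then 1 else 0 with hn
  set k : V → ℝ := fun x => if G.Adj v x ∧ G.Adj u x then 1 else 0 with hk
  set i : V → ℝ := 1 with hi
  set c : ℝ := (G.degree v : ℝ) with hc
  set m : ℝ := (#{w ∈ G.neighborFinset v | G.Adj u w} : ℝ) with hm
  have hn0 : ∀ x, n x = 0 ∨ G.Adj v x := fun x => by by_cases hx : G.Adj v x <;> simp [hn, hx]
  have hk0 : ∀ x, k x = 0 ∨ G.Adj v x := fun x => by by_cases hx : G.Adj v x <;> simp [hk, hx]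
  have indep : ∀ p q : V → ℝ, (∀ x, p x = 0 ∨ G.Adj v x) → (∀ x, q x = 0 ∨ G.Adj v x) →
      p ⬝ᵥ (A *ᵥ q) = 0 := by
    intro p q hp hq
    refine sum_eq_zero fun x _ => ?_
    rcases hp x with hx | hx
    · rw [hx, zero_mul]
    · rw [hA, adjMatrix_mulVec_apply, sum_eq_zero, mul_zero]
      intro z hz
      rw [mem_neighborFinset] at hz
      exact (hq z).resolve_right (h.triangleFree v x z hx hz)
  have As : A *ᵥ s = n := by
    ext x; simp [hA, hs, hn, G.adj_comm v x]
  have sA : ∀ p, s ⬝ᵥ (A *ᵥ p) = n ⬝ᵥ p := fun p => by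
    rw [hA, G.dotProduct_adjMatrix_mulVec_comm, ← hA, As, dotProduct_comm]
  have rA : ∀ p, r ⬝ᵥ (A *ᵥ p) = ∑ x, if G.Adj u x then p x else 0 := fun p => by
    rw [hr, single_dotProduct, one_mul, hA, adjMatrix_mulVec_apply, neighborFinset_eq_filter,
      sum_filter]
  have in' : i ⬝ᵥ n = c := by simp [hi, hn, hc, dotProduct, ← neighborFinset_eq_filter]
  have ik : i ⬝ᵥ k = m := by
    simp [hi, hk, hm, dotProduct, neighborFinset_eq_filter, filter_filter]
  have nn : n ⬝ᵥ n = c := by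
    rw [← in']; exact sum_congr rfl fun x _ => by simp only [hn, hi]; split_ifs <;> simp
  have nk : n ⬝ᵥ k = m := by
    rw [← ik]
    refine sum_congr rfl fun x _ => ?_
    by_cases h1 : G.Adj v x <;> simp [hn, hk, hi, h1]
  have kk : k ⬝ᵥ k = m := by
    rw [← ik]; exact sum_congr rfl fun x _ => by simp only [hk, hi]; split_ifs <;> simp
  have rAn : r ⬝ᵥ (A *ᵥ n) = m := by
    rw [rA, ← ik]
    refine sum_congr rfl fun x _ => ?_
    by_cases h1 : G.Adj v x <;> by_cases h2 : G.Adj u x <;> simp [hn, hk, hi, h1, h2]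
  have rAk : r ⬝ᵥ (A *ᵥ k) = m := by
    rw [rA, ← ik]
    refine sum_congr rfl fun x _ => ?_
    by_cases h1 : G.Adj v x <;> by_cases h2 : G.Adj u x <;> simp [hk, hi, h1, h2]
  have rAr : r ⬝ᵥ (A *ᵥ r) = 0 := by
    rw [rA]
    exact sum_eq_zero fun x _ => by
      by_cases hx : x = u
      · subst hx; simp
      · simp [hr, hx]
  have nr : n ⬝ᵥ r = 0 := by simp [hr, hn, hadj]
  have ns : n ⬝ᵥ s = 0 := by simp [hs, hn]
  have kr : k ⬝ᵥ r = 0 := by simp [hr, hk]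
  have ks : k ⬝ᵥ s = 0 := by simp [hs, hk]
  have rs : r ⬝ᵥ s = 0 := by simp [hr, hs, huv.symm]
  have ss : s ⬝ᵥ s = 1 := by simp [hs]
  have rr : r ⬝ᵥ r = 1 := by simp [hr]
  have is : i ⬝ᵥ s = 1 := by simp [hs, hi]
  have ir : i ⬝ᵥ r = 1 := by simp [hr, hi]
  have comm := fun p q => G.dotProduct_adjMatrix_mulVec_comm p q
  have nAs : n ⬝ᵥ (A *ᵥ s) = c := by rw [As, nn]
  have kAs : k ⬝ᵥ (A *ᵥ s) = m := by rw [As, dotProduct_comm, nk]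
  have rAs : r ⬝ᵥ (A *ᵥ s) = 0 := by rw [As, dotProduct_comm, nr]
  have nAr : n ⬝ᵥ (A *ᵥ r) = m := by rw [hA, comm, ← hA, rAn]
  have kAr : k ⬝ᵥ (A *ᵥ r) = m := by rw [hA, comm, ← hA, rAk]
  -- The vector is 6 at u, 2 on common neighbours and -1 on the other neighbours of v. The value at
  -- v minimizes the slack, after which the terms quadratic in c and m cancel.
  have key := h.form_le (((3 * m - c - 2) / 3) • s + (6 : ℝ) • r - n + (3 : ℝ) • k)
  rw [← one_dotProduct, ← hi, ← hA] at key
  simp only [add_dotProduct, sub_dotProduct, dotProduct_add, dotProduct_sub, smul_dotProduct,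
    dotProduct_smul, mulVec_add, mulVec_sub, mulVec_smul, smul_eq_mul, sA, nAs, kAs, rAs, nAr, kAr,
    rAn, rAk, rAr, indep n n hn0 hn0, indep n k hn0 hk0, indep k n hk0 hn0, indep k k hk0 hk0,
    nn, nk, kk, nr, ns, kr, ks, rs, ss, rr, is, ir, in', ik,
    dotProduct_comm k n, dotProduct_comm r n, dotProduct_comm s n, dotProduct_comm r k,
    dotProduct_comm s k, dotProduct_comm s r] at key
  have : c + 3 * m ≤ 40 := by nlinarith
  rw [hc, hm] at this
  exact_mod_cast this

/-- Count walks of length two from v by their endpoint: v itself receives its degree, neighbours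
receive none by triangle-freeness, and all others at most M. -/
theorem degreeSum₂_le_of_common (h : IsLinkGraph G) (v : V) {M : ℕ}
    (hM : ∀ u, u ≠ v → ¬ G.Adj v u → #{w ∈ G.neighborFinset v | G.Adj u w} ≤ M) :
    (G.degreeSum₂ v : ℝ) ≤ G.degree v + M * (Fintype.card V - 1 - G.degree v) := by
  have h1 : G.degreeSum₂ v = ∑ u, #{w ∈ G.neighborFinset v | G.Adj u w} := by
    simp only [degreeSum₂, card_filter]
    rw [sum_comm]
    refine sum_congr rfl fun w _ => ?_
    rw [← card_filter, ← card_neighborFinset_eq_degree, neighborFinset_eq_filter]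
    congr 1; ext x; simp [G.adj_comm]
  have h2 : ∀ u, #{w ∈ G.neighborFinset v | G.Adj u w} ≤
      (if u = v then G.degree v else 0) + if u ≠ v ∧ ¬ G.Adj v u then M else 0 := by
    intro u
    by_cases huv : u = v
    · subst huv
      simp only [if_true]
      exact (card_filter_le _ _).trans (by simp)
    · by_cases hadj : G.Adj v u
      · rw [card_eq_zero.2]; · simp
        refine filter_eq_empty_iff.2 fun w hw hw' => ?_
        rw [mem_neighborFinset] at hw
        exact h.triangleFree v u w hadj hw' hw
      · simpa [huv, hadj] using hM u huv hadj
  have h3 : G.degreeSum₂ v ≤ G.degree v + M * #{x | x ≠ v ∧ ¬ G.Adj v x} := by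
    rw [h1]
    refine (sum_le_sum fun u _ => h2 u).trans ?_
    rw [sum_add_distrib, sum_ite_eq' univ v, if_pos (mem_univ v), ← sum_filter, sum_const,
      smul_eq_mul, mul_comm]
  rw [← card_antineighbors]
  exact_mod_cast h3

end

end IsLinkGraph

/-! ### The bound on the order of a link graph -/

namespace IsLinkGraph

open Finset Matrix SimpleGraph

universe u

variable {V : Type u} [Fintype V] [DecidableEq V] {G : SimpleGraph V} [DecidableRel G.Adj]

/-- Restriction to a set of `N` vertices that contains the closed neighbourhood of `v`. -/
theorem exists_restrict (h : IsLinkGraph G) (v : V) {Δ N : ℕ} (hΔ : ∀ x, G.degree x ≤ Δ)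
    (hv : G.degree v < N) (hN : N ≤ Fintype.card V) :
    ∃ (W : Type u) (_ : Fintype W) (_ : DecidableEq W) (H : SimpleGraph W)
      (_ : DecidableRel H.Adj) (w : W), IsLinkGraph H ∧ Fintype.card W = N ∧
        H.degree w = G.degree v ∧ ∀ x, H.degree x ≤ Δ := by
  obtain ⟨U, hU, -, hcard⟩ := exists_subsuperset_card_eq (s := insert v (G.neighborFinset v))
    (t := univ) (n := N) (subset_univ _)
    (by rw [card_insert_of_notMem (by simp), card_neighborFinset_eq_degree]; omega)
    (by rwa [card_univ])
  let f : {x // x ∈ U} ↪ V := Function.Embedding.subtype _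
  have hmap : ∀ x : {x // x ∈ U},
      ((G.comap f).neighborFinset x).map f ⊆ G.neighborFinset x.1 := by
    intro x y hy
    obtain ⟨z, hz, rfl⟩ := mem_map.1 hy
    rw [mem_neighborFinset] at hz ⊢
    exact hz
  have hle : ∀ x : {x // x ∈ U}, (G.comap f).degree x ≤ G.degree x.1 := by
    intro x
    rw [← card_neighborFinset_eq_degree, ← card_map f, ← card_neighborFinset_eq_degree]
    exact card_le_card (hmap x)
  refine ⟨{x // x ∈ U}, inferInstance, inferInstance, G.comap f, inferInstance,
    ⟨v, hU (mem_insert_self _ _)⟩, h.comap f, by rw [Fintype.card_coe, hcard],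
    le_antisymm (hle _) ?_, fun x => (hle x).trans (hΔ _)⟩
  rw [← card_neighborFinset_eq_degree, ← card_neighborFinset_eq_degree, ← card_map f]
  refine card_le_card fun x hx => mem_map.2 ⟨⟨x, hU (mem_insert_of_mem hx)⟩, ?_, rfl⟩
  rw [mem_neighborFinset] at hx ⊢
  exact hx

theorem card_le_of_degree_le_four (h : IsLinkGraph G) (hΔ : ∀ x, G.degree x ≤ 4) :
    Fintype.card V ≤ 92 := by
  have h1 := h.sum_degree_ge
  have h2 : ∑ v, (G.degree v : ℝ) ≤ ∑ _v : V, (4 : ℝ) :=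
    sum_le_sum fun v _ => by exact_mod_cast hΔ v
  simp only [sum_const, card_univ, nsmul_eq_mul] at h2
  have : (Fintype.card V : ℝ) < 93 := by linarith
  exact Nat.lt_succ_iff.1 (by exact_mod_cast this)

theorem false_of_degree_le_sixteen (h : IsLinkGraph G) {v : V} (hv : ∀ x, G.degree x ≤ G.degree v)
    (h5 : 5 ≤ G.degree v) (h16 : G.degree v ≤ 16)
    (hN : Fintype.card V = (279 + 2 * G.degree v) / 3) : False := by
  have hT := h.sum_degree_antineighbors_ge v
  have hD : (G.degreeSum₂ v : ℝ) ≤ G.degree v * G.degree v := by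
    exact_mod_cast G.degreeSum₂_le hv v
  have hs := fun b => h.star_le v ((3 * G.degree v * b -
    (Fintype.card V - 1 - G.degree v)) / 9) b
  -- With a already optimal, this b minimizes the slack at the extreme value D = c². Eliminating E
  -- against `hT` then leaves a contradiction with D ≤ c².
  replace hs := hs (-((Fintype.card V - 1 - G.degree v) - 3 * (G.degree v - 1)) / 6)
  rw [hN] at hT hs
  generalize G.degree v = c at *
  generalize ∑ x, (G.degree x : ℝ) = E at *
  generalize (G.degreeSum₂ v : ℝ) = D at *
  clear hN hv
  interval_cases c <;> norm_num at hT hD hs <;> linarith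

theorem sum_degree_le_of_degree_ge (h : IsLinkGraph G) {v : V} (h23 : 23 ≤ G.degree v)
    (hN : Fintype.card V = 104) (hE : 515 ≤ ∑ x, (G.degree x : ℝ)) :
    G.degree v ≤ 25 ∧ ∑ x, (G.degree x : ℝ) ≤ 1457 := by
  have hM : ∀ u, u ≠ v → ¬ G.Adj v u →
      #{w ∈ G.neighborFinset v | G.Adj u w} ≤ (40 - G.degree v) / 3 := by
    intro u hu huv
    have := h.degree_add_three_mul_card_common_le hu huv
    omega
  have hD := h.degreeSum₂_le_of_common v hM
  have h27 := h.degree_le_27 v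
  have hs := fun b => h.star_le v ((3 * G.degree v * b -
    (Fintype.card V - 1 - G.degree v)) / 9) b
  -- The minimizing b when D equals the upper bound `hD` coming from common neighbours.
  replace hs := hs (-((Fintype.card V - 1 - G.degree v) -
    3 * ((((40 - G.degree v) / 3 : ℕ) : ℝ) * (Fintype.card V - 1 - G.degree v)) / G.degree v) / 6)
  rw [hN] at hD hs
  generalize G.degree v = c at *
  generalize ∑ x, (G.degree x : ℝ) = E at *
  generalize (G.degreeSum₂ v : ℝ) = D at *
  clear hM
  interval_cases c <;> norm_num at hD hs <;>
    first | (exfalso; linarith) | exact ⟨by norm_num, by linarith⟩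

theorem false_of_card_eq (h : IsLinkGraph G) {v : V} (hv : ∀ x, G.degree x ≤ G.degree v)
    (hN : Fintype.card V = 104) : False := by
  have hE : (515 : ℝ) ≤ ∑ x, (G.degree x : ℝ) := by
    have := h.sum_degree_ge
    rw [hN] at this
    norm_num at this
    linarith
  have low : G.degree v ≤ 25 → ∑ x, (G.degree x : ℝ) ≤ 1457 → False := by
    intro h25 hE'
    have hΔ : ∀ x, G.degree x ≤ 25 := fun x => (hv x).trans h25
    rcases le_total (∑ x, (G.degree x : ℝ)) 675 with h1 | h1
    · exact h.false_of_cell hN hΔ degreeSumCell_515 hE h1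
    rcases le_total (∑ x, (G.degree x : ℝ)) 955 with h2 | h2
    · exact h.false_of_cell hN hΔ degreeSumCell_675 h1 h2
    rcases le_total (∑ x, (G.degree x : ℝ)) 1215 with h3 | h3
    · exact h.false_of_cell hN hΔ degreeSumCell_955 h2 h3
    · exact h.false_of_cell hN hΔ degreeSumCell_1215 h3 hE'
  by_cases h22 : G.degree v ≤ 22
  · have hΔ : ∀ x, G.degree x ≤ 22 := fun x => (hv x).trans h22
    rcases le_total (∑ x, (G.degree x : ℝ)) 1456 with h1 | h1
    · exact low (by omega) (by linarith)
    rcases le_total (∑ x, (G.degree x : ℝ)) 1716 with h2 | h2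
    · exact h.false_of_cell hN hΔ degreeSumCell_1456 h1 h2
    rcases le_total (∑ x, (G.degree x : ℝ)) 1916 with h3 | h3
    · exact h.false_of_cell hN hΔ degreeSumCell_1716 h2 h3
    rcases le_total (∑ x, (G.degree x : ℝ)) 2096 with h4 | h4
    · exact h.false_of_cell hN hΔ degreeSumCell_1916 h3 h4
    refine h.false_of_cell hN hΔ degreeSumCell_2096 h4 ?_
    have : ∑ x, (G.degree x : ℝ) ≤ ∑ _x : V, (22 : ℝ) :=
      sum_le_sum fun x _ => by exact_mod_cast hΔ x
    rw [sum_const, card_univ, hN] at this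
    norm_num at this
    linarith
  · obtain ⟨h25, hE'⟩ := h.sum_degree_le_of_degree_ge (v := v) (by omega) hN hE
    exact low h25 hE'

theorem three_mul_card_le (h : IsLinkGraph G) {Δ : ℕ} (hΔ : ∀ x, G.degree x ≤ Δ) :
    3 * Fintype.card V ≤ 276 + 2 * Δ := by
  by_contra! hlt
  have : Nonempty V := Fintype.card_pos_iff.1 (by omega)
  obtain ⟨v, hv⟩ := G.exists_maximal_degree_vertex
  have hmax : ∀ x, G.degree x ≤ G.degree v := fun x => hv ▸ G.degree_le_maxDegree x
  have hvΔ := hΔ v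
  have h27 := h.degree_le_27 v
  by_cases h4 : G.degree v ≤ 4
  · have := h.card_le_of_degree_le_four fun x => (hmax x).trans h4
    omega
  by_cases h16 : G.degree v ≤ 16
  · obtain ⟨W, _, _, H, _, w, hH, hcard, hw, hle⟩ :=
      -- This N is the least integer with 3N > 276 + 2 deg v; keeping the closed neighbourhood of v
      -- keeps its degree maximal.
      h.exists_restrict v (N := (279 + 2 * G.degree v) / 3) hmax (by omega) (by omega)
    rw [← hw] at hle hcard
    exact hH.false_of_degree_le_sixteen hle (by omega) (by omega) hcard
  · obtain ⟨W, _, _, H, _, w, hH, hcard, hw, hle⟩ :=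
      -- From degree 17 on, a violation has at least 104 vertices.
      h.exists_restrict v (N := 104) hmax (by omega) (by omega)
    rw [← hw] at hle
    exact hH.false_of_card_eq hle hcard

end IsLinkGraph

/-! ### Negative triples, switching and positive semidefiniteness -/

/-- The product of the entries of `S` on a triple of indices. -/
def seidelTriple {V : Type*} (S : Matrix V V ℝ) (i j k : V) : ℝ := S i j * S j k * S i k

namespace IsSeidelMatrix

open Finset Matrix

variable {V : Type*} {S : Matrix V V ℝ}

theorem comm (hS : IsSeidelMatrix S) (i j : V) : S i j = S j i := hS.isSymm.apply j i

theorem mul_self (hS : IsSeidelMatrix S) {i j : V} (h : i ≠ j) : S i j * S i j = 1 := by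
  rcases hS.off_diag i j h with h | h <;> rw [h] <;> norm_num

theorem triple_swap_right (hS : IsSeidelMatrix S) (i j k : V) :
    seidelTriple S i k j = seidelTriple S i j k := by
  simp only [seidelTriple, hS.comm k j]; ring

theorem triple_rotate (hS : IsSeidelMatrix S) (i j k : V) :
    seidelTriple S j k i = seidelTriple S i j k := by
  simp only [seidelTriple, hS.comm j i, hS.comm k i]; ring

theorem triple_eq (hS : IsSeidelMatrix S) {i j k : V} (h₁ : i ≠ j) (h₂ : j ≠ k) (h₃ : i ≠ k) :
    seidelTriple S i j k = 1 ∨ seidelTriple S i j k = -1 := by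
  unfold seidelTriple
  rcases hS.off_diag i j h₁ with h | h <;> rcases hS.off_diag j k h₂ with h' | h' <;>
    rcases hS.off_diag i k h₃ with h'' | h'' <;> simp [h, h', h'']

theorem ne_of_triple (hS : IsSeidelMatrix S) {i j k : V} (h : seidelTriple S i j k = -1) :
    i ≠ j ∧ j ≠ k ∧ i ≠ k := by
  refine ⟨?_, ?_, ?_⟩ <;> rintro rfl <;> simp [seidelTriple, hS.diag] at h

/-- The cocycle identity: each entry involving x occurs twice and cancels. -/
theorem triple_mul (hS : IsSeidelMatrix S) {u v w x : V} (hu : x ≠ u) (hv : x ≠ v) (hw : x ≠ w) :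
    seidelTriple S u v x * seidelTriple S u w x * seidelTriple S v w x = seidelTriple S u v w := by
  have h1 := hS.mul_self hu.symm
  have h2 := hS.mul_self hv.symm
  have h3 := hS.mul_self hw.symm
  calc _ = S u v * S v w * S u w * (S u x * S u x) * (S v x * S v x) * (S w x * S w x) := by
        simp only [seidelTriple]; ring
    _ = _ := by rw [h1, h2, h3]; simp [seidelTriple]

theorem injective_sign (ε : V → ℝ) :
    Function.Injective fun i : V => (if ε i = 1 then Sum.inl i else Sum.inr i : V ⊕ V) := by
  intro i j hij
  dsimp only at hij
  split_ifs at hij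
  · exact Sum.inl_injective hij
  · exact Sum.inr_injective hij

section Switching

variable [DecidableEq V]

theorem switchingMatrix_apply_of_ne (S : Matrix V V ℝ) {ε : V → ℝ} (hε : ∀ i, ε i = 1 ∨ ε i = -1)
    {i j : V} (hij : i ≠ j) :
    _root_.switchingMatrix S (if ε i = 1 then Sum.inl i else Sum.inr i)
      (if ε j = 1 then Sum.inl j else Sum.inr j) = ε i * ε j * S i j := by
  rcases hε i with h | h <;> rcases hε j with h' | h' <;>
    norm_num [h, h', _root_.switchingMatrix, hij]

/-- The sign that switches `u` to be adjacent to all other indices. -/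
theorem sign_eq (hS : IsSeidelMatrix S) (u : V) {a : ℝ} (ha : a = 1 ∨ a = -1) (i : V) :
    (if i = u then a else -S u i) = 1 ∨ (if i = u then a else -S u i) = -1 := by
  split_ifs with h
  · exact ha
  · rcases hS.off_diag u i (Ne.symm h) with h' | h' <;> simp [h']

theorem switchingGraph_adj (hS : IsSeidelMatrix S) {p q : V ⊕ V} (h : (switchingGraph S).Adj p q) :
    Sum.elim (fun _ => (1 : ℝ)) (fun _ => -1) p * Sum.elim (fun _ => (1 : ℝ)) (fun _ => -1) q *
      S (Sum.elim id id p) (Sum.elim id id q) = -1 := by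
  have h1 := ((seidelGraph_adj hS.switchingMatrix _ _).1 h).2
  rcases p with i | i <;> rcases q with j | j
  · simpa [_root_.switchingMatrix] using h1
  · by_cases hij : i = j
    · subst hij; norm_num [_root_.switchingMatrix, hS.diag] at h1
    · simpa [_root_.switchingMatrix, hij] using h1
  · by_cases hij : i = j
    · subst hij; norm_num [_root_.switchingMatrix, hS.diag] at h1
    · simpa [_root_.switchingMatrix, hij] using h1
  · simpa [_root_.switchingMatrix] using h1

theorem exists_triple (hS : IsSeidelMatrix S) (h : 3 ≤ switchingCliqueNum S) :
    ∃ u v w, seidelTriple S u v w = -1 := by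
  obtain ⟨s, hs⟩ := (switchingGraph S).exists_isNClique_cliqueNum
  obtain ⟨p, q, r, hp, hq, hr, hpq, hpr, hqr⟩ := two_lt_card_iff.1 (hs.card_eq.symm ▸ h : 2 < #s)
  have h1 := hS.switchingGraph_adj (hs.isClique hp hq hpq)
  have h2 := hS.switchingGraph_adj (hs.isClique hq hr hqr)
  have h3 := hS.switchingGraph_adj (hs.isClique hp hr hpr)
  refine ⟨Sum.elim id id p, Sum.elim id id q, Sum.elim id id r, ?_⟩
  have sq : ∀ p : V ⊕ V, Sum.elim (fun _ => (1 : ℝ)) (fun _ => -1) p *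
      Sum.elim (fun _ => (1 : ℝ)) (fun _ => -1) p = 1 := by
    rintro (i | i) <;> norm_num
  have key : ∀ a b c x y z : ℝ, a * a = 1 → b * b = 1 → c * c = 1 → a * b * x = -1 →
      b * c * y = -1 → a * c * z = -1 → x * y * z = -1 := by
    intro a b c x y z ha hb hc hx hy hz
    calc x * y * z = (a * a) * (b * b) * (c * c) * (x * y * z) := by rw [ha, hb, hc]; ring
      _ = (a * b * x) * (b * c * y) * (a * c * z) := by ring
      _ = -1 := by rw [hx, hy, hz]; norm_num
  exact key _ _ _ _ _ _ (sq p) (sq q) (sq r) h1 h2 h3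

variable [Finite V]

theorem card_le_cliqueNum (hS : IsSeidelMatrix S) {ε : V → ℝ} (hε : ∀ i, ε i = 1 ∨ ε i = -1)
    {I : Finset V} (hI : ∀ i ∈ I, ∀ j ∈ I, i ≠ j → ε i * ε j * S i j = -1) :
    #I ≤ switchingCliqueNum S := by
  rw [← card_map ⟨_, injective_sign ε⟩]
  refine SimpleGraph.IsClique.card_le_cliqueNum (tc := ?_)
  intro p hp q hq hpq
  obtain ⟨i, hi, rfl⟩ := mem_map.1 hp
  obtain ⟨j, hj, rfl⟩ := mem_map.1 hq
  have hij : i ≠ j := fun h => hpq (h ▸ rfl)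
  refine (seidelGraph_adj hS.switchingMatrix _ _).2 ⟨hpq, ?_⟩
  exact (switchingMatrix_apply_of_ne S hε hij).trans (hI i hi j hj hij)

theorem card_le_indepNum (hS : IsSeidelMatrix S) {ε : V → ℝ} (hε : ∀ i, ε i = 1 ∨ ε i = -1)
    {I : Finset V} (hI : ∀ i ∈ I, ∀ j ∈ I, i ≠ j → ε i * ε j * S i j = 1) :
    #I ≤ switchingIndepNum S := by
  rw [← card_map ⟨_, injective_sign ε⟩]
  refine SimpleGraph.IsIndepSet.card_le_indepNum ?_
  intro p hp q hq hpq hadj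
  obtain ⟨i, hi, rfl⟩ := mem_map.1 hp
  obtain ⟨j, hj, rfl⟩ := mem_map.1 hq
  have hij : i ≠ j := fun h => hpq (h ▸ rfl)
  have h1 := ((seidelGraph_adj hS.switchingMatrix _ _).1 hadj).2
  have h2 := (switchingMatrix_apply_of_ne S hε hij).trans (hI i hi j hj hij)
  simp only [Function.Embedding.coeFn_mk] at h1
  rw [h2] at h1
  norm_num at h1

/-- After switching so that u is adjacent to everything, the entry at i, j is the sign of the triple
u, i, j. -/
theorem card_lt_cliqueNum_of_triple (hS : IsSeidelMatrix S) {u : V} {J : Finset V} (hu : u ∉ J)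
    (hJ : ∀ i ∈ J, ∀ j ∈ J, i ≠ j → seidelTriple S u i j = -1) :
    #J + 1 ≤ switchingCliqueNum S := by
  rw [← card_insert_of_notMem hu]
  refine hS.card_le_cliqueNum (hS.sign_eq u (Or.inl rfl)) fun i hi j hj hij => ?_
  rcases mem_insert.1 hi with hi' | hi' <;> rcases mem_insert.1 hj with hj' | hj'
  · exact absurd (hi'.trans hj'.symm) hij
  · have hju : j ≠ u := fun h => hu (h ▸ hj')
    rw [if_pos hi', if_neg hju, hi']
    linarith [hS.mul_self hju.symm]
  · have hiu : i ≠ u := fun h => hu (h ▸ hi')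
    rw [if_pos hj', if_neg hiu, hj', hS.comm i u]
    linarith [hS.mul_self hiu.symm]
  · have hiu : i ≠ u := fun h => hu (h ▸ hi')
    have hju : j ≠ u := fun h => hu (h ▸ hj')
    rw [if_neg hiu, if_neg hju, ← hJ i hi' j hj' hij,
      seidelTriple]
    ring

theorem card_lt_indepNum_of_triple (hS : IsSeidelMatrix S) {u : V} {J : Finset V} (hu : u ∉ J)
    (hJ : ∀ i ∈ J, ∀ j ∈ J, i ≠ j → seidelTriple S u i j = 1) :
    #J + 1 ≤ switchingIndepNum S := by
  rw [← card_insert_of_notMem hu]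
  -- The sign -1 at u reverses its adjacencies, so u is non-adjacent to all of J.
  refine hS.card_le_indepNum (hS.sign_eq u (Or.inr rfl)) fun i hi j hj hij => ?_
  rcases mem_insert.1 hi with hi' | hi' <;> rcases mem_insert.1 hj with hj' | hj'
  · exact absurd (hi'.trans hj'.symm) hij
  · have hju : j ≠ u := fun h => hu (h ▸ hj')
    rw [if_pos hi', if_neg hju, hi']
    linarith [hS.mul_self hju.symm]
  · have hiu : i ≠ u := fun h => hu (h ▸ hi')
    rw [if_pos hj', if_neg hiu, hj', hS.comm i u]
    linarith [hS.mul_self hiu.symm]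
  · have hiu : i ≠ u := fun h => hu (h ▸ hi')
    have hju : j ≠ u := fun h => hu (h ▸ hj')
    rw [if_neg hiu, if_neg hju, ← hJ i hi' j hj' hij,
      seidelTriple]
    ring

end Switching

theorem dotProduct_mulVec_nonneg [Fintype V] [DecidableEq V] (hS : IsSeidelMatrix S)
    (hmin : IsSmallestEigenvalue S (-5)) (x : V → ℝ) :
    0 ≤ 5 * (x ⬝ᵥ x) + x ⬝ᵥ (S *ᵥ x) := by
  have hH : (S + (5 : ℝ) • (1 : Matrix V V ℝ)).IsHermitian := by
    rw [IsHermitian, conjTranspose_eq_transpose_of_trivial, transpose_add, transpose_smul,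
      transpose_one, hS.isSymm.eq]
  have hpsd : (S + (5 : ℝ) • (1 : Matrix V V ℝ)).PosSemidef := by
    refine hH.posSemidef_iff_eigenvalues_nonneg.2 fun j => ?_
    have h1 := hH.mulVec_eigenvectorBasis j
    have hne : (hH.eigenvectorBasis j).ofLp ≠ 0 := fun h =>
      hH.eigenvectorBasis.orthonormal.ne_zero j (by ext i; exact congrFun h i)
    have h2 : Module.End.HasEigenvalue (Matrix.toLin' S) (hH.eigenvalues j - 5) := by
      refine Module.End.hasEigenvalue_of_hasEigenvector
        (x := (hH.eigenvectorBasis j).ofLp) ⟨?_, hne⟩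
      rw [Module.End.mem_eigenspace_iff, Matrix.toLin'_apply, sub_smul, ← h1, add_mulVec,
        smul_mulVec, one_mulVec, add_sub_cancel_right]
    have := hmin.2 h2
    simp only [Pi.zero_apply]
    linarith
  have := hpsd.dotProduct_mulVec_nonneg x
  rw [add_mulVec, smul_mulVec, one_mulVec, dotProduct_add, dotProduct_smul, star_trivial,
    smul_eq_mul] at this
  linarith

/-- The graph on the indices `w` for which the triple `u`, `v`, `w` is negative; two of them are
adjacent when they form a negative triple with `u`. -/
def linkGraph (hS : IsSeidelMatrix S) (u v : V) : SimpleGraph {w // seidelTriple S u v w = -1} where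
  Adj x y := seidelTriple S u x y = -1
  symm := ⟨fun x y h => by rw [hS.triple_swap_right]; exact h⟩
  loopless := ⟨fun x h => by simp [seidelTriple, hS.diag] at h⟩

end IsSeidelMatrix

/-! ### Link graphs of a Seidel matrix and the final count -/

namespace IsSeidelMatrix

open Finset Matrix

variable {V : Type*} [Fintype V] {S : Matrix V V ℝ}

/-- The number of indices that form negative triples with all pairs from `u`, `v`, `w`. -/
noncomputable def commonCount (S : Matrix V V ℝ) (t : V × V × V) : ℕ := by
  classical exact #{x | seidelTriple S t.1 t.2.1 x = -1 ∧ seidelTriple S t.1 t.2.2 x = -1 ∧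
    seidelTriple S t.2.1 t.2.2 x = -1}

open Classical in
theorem degree_linkGraph (hS : IsSeidelMatrix S) (u v : V)
    (w : {w // seidelTriple S u v w = -1}) :
    (hS.linkGraph u v).degree w = commonCount S (u, v, w.1) := by
  rw [← SimpleGraph.card_neighborFinset_eq_degree, ← card_map (Function.Embedding.subtype _),
    commonCount]
  congr 1
  ext x
  simp only [mem_map, SimpleGraph.mem_neighborFinset, mem_filter, mem_univ, true_and]
  constructor
  · rintro ⟨x, hx, rfl⟩
    have h1 : seidelTriple S u w x = -1 := hx
    refine ⟨x.2, h1, ?_⟩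
    have dx := hS.ne_of_triple x.2
    have := hS.triple_mul dx.2.2.symm dx.2.1.symm (hS.ne_of_triple h1).2.1.symm
    rw [w.2, h1, x.2] at this
    simpa using this
  · rintro ⟨h1, h2, -⟩
    exact ⟨⟨x, h1⟩, h2, rfl⟩

open Classical in
-- By `triple_mul`, a point x outside the triple lies in one or three of the link sets of its pairs,
-- and in three exactly when it is counted by `commonCount`. Each of u, v, w lies in exactly one.
theorem card_add_two_mul_commonCount (hS : IsSeidelMatrix S) {u v w : V}
    (h : seidelTriple S u v w = -1) : Fintype.card V + 2 * commonCount S (u, v, w) =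
      Fintype.card {x // seidelTriple S u v x = -1} +
      Fintype.card {x // seidelTriple S u w x = -1} +
      Fintype.card {x // seidelTriple S v w x = -1} := by
  rw [Fintype.card_subtype, Fintype.card_subtype, Fintype.card_subtype, commonCount, card_filter,
    card_filter, card_filter, card_filter, ← card_univ, card_eq_sum_ones, mul_sum,
    ← sum_add_distrib, ← sum_add_distrib, ← sum_add_distrib]
  refine sum_congr rfl fun x _ => ?_
  obtain ⟨huv, hvw, huw⟩ := hS.ne_of_triple h
  by_cases hu : x = u
  · subst hu
    have h1 : seidelTriple S v w x = -1 := by rw [hS.triple_rotate, h]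
    simp [h1, show ∀ a, seidelTriple S x a x = 0 from fun a => by simp [seidelTriple, hS.diag]]
  by_cases hv : x = v
  · subst hv
    have h1 : seidelTriple S u w x = -1 := by rw [hS.triple_swap_right, h]
    simp [h1, show ∀ a, seidelTriple S x a x = 0 from fun a => by simp [seidelTriple, hS.diag],
      show ∀ a, seidelTriple S a x x = 0 from fun a => by simp [seidelTriple, hS.diag]]
  by_cases hw : x = w
  · subst hw
    simp [h, show ∀ a, seidelTriple S a x x = 0 from fun a => by simp [seidelTriple, hS.diag]]
  have hm := hS.triple_mul hu hv hw
  rw [h] at hm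
  rcases hS.triple_eq huv (Ne.symm hv) (Ne.symm hu) with h1 | h1 <;>
    rcases hS.triple_eq huw (Ne.symm hw) (Ne.symm hu) with h2 | h2 <;>
    rcases hS.triple_eq hvw (Ne.symm hw) (Ne.symm hv) with h3 | h3 <;>
    first
      | (norm_num [h1, h2, h3] at hm; done)
      | norm_num [h1, h2, h3]

variable [DecidableEq V]

theorem linkGraph_form_le (hS : IsSeidelMatrix S) (hmin : IsSmallestEigenvalue S (-5)) {u v : V}
    (huv : u ≠ v) [DecidablePred fun w => seidelTriple S u v w = -1]
    [DecidableRel (hS.linkGraph u v).Adj] (y : {w // seidelTriple S u v w = -1} → ℝ) :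
    4 * (y ⬝ᵥ ((hS.linkGraph u v).adjMatrix ℝ *ᵥ y)) ≤ 8 * (y ⬝ᵥ y) + (∑ x, y x) ^ 2 := by
  set f : {w // seidelTriple S u v w = -1} ↪ V := Function.Embedding.subtype _ with hf
  set z : V → ℝ := Function.extend f (fun w => -S u w * y w) (fun _ => 0) with hz
  have hne : ∀ w : {w // seidelTriple S u v w = -1}, u ≠ w ∧ v ≠ w := fun w =>
    ⟨(hS.ne_of_triple w.2).2.2, (hS.ne_of_triple w.2).2.1⟩
  have e : ∀ w, z (f w) = -S u w * y w := fun w => f.injective.extend_apply _ _ w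
  have e0 : ∀ x ∉ Set.range f, z x = 0 := fun x hx =>
    Function.extend_apply' _ _ x fun ⟨w, hw⟩ => hx ⟨w, hw⟩
  set σ : ℝ := ∑ x, y x with hσ
  set p : V → ℝ := Pi.single u 1 with hp
  set q : V → ℝ := Pi.single v 1 with hq
  have hrow : ∀ c : V → ℝ, ∑ x, c x * z x = ∑ w : {w // seidelTriple S u v w = -1},
      c w * (-S u w * y w) := fun c => (Fintype.sum_of_injective f f.injective _ _
        (fun x hx => by rw [e0 x hx, mul_zero]) fun w => by rw [e]; rfl).symm
  have zu : z u = 0 := e0 u fun ⟨w, hw⟩ => (hne w).1 hw.symm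
  have zv : z v = 0 := e0 v fun ⟨w, hw⟩ => (hne w).2 hw.symm
  have pp : p ⬝ᵥ p = 1 := by simp [hp]
  have qq : q ⬝ᵥ q = 1 := by simp [hq]
  have pq : p ⬝ᵥ q = 0 := by simp [hp, hq, huv]
  have qp : q ⬝ᵥ p = 0 := by simp [hp, hq, huv.symm]
  have pz : p ⬝ᵥ z = 0 := by simp [hp, zu]
  have qz : q ⬝ᵥ z = 0 := by simp [hq, zv]
  have zz : z ⬝ᵥ z = y ⬝ᵥ y := by
    rw [dotProduct, hrow]
    refine sum_congr rfl fun w _ => ?_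
    have h1 : z w = -S u w * y w := e w
    rw [h1]
    linear_combination (y w * y w) * hS.mul_self (hne w).1
  have comm : ∀ a b : V → ℝ, a ⬝ᵥ (S *ᵥ b) = b ⬝ᵥ (S *ᵥ a) := fun a b => by
    rw [dotProduct_mulVec, ← mulVec_transpose, hS.isSymm.eq, dotProduct_comm]
  have pSp : p ⬝ᵥ (S *ᵥ p) = 0 := by simp [hp, hS.diag]
  have qSq : q ⬝ᵥ (S *ᵥ q) = 0 := by simp [hq, hS.diag]
  have pSq : p ⬝ᵥ (S *ᵥ q) = S u v := by simp [hp, hq]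
  have pSz : p ⬝ᵥ (S *ᵥ z) = -σ := by
    rw [hp, single_dotProduct, one_mul, mulVec, dotProduct, hrow, hσ, ← sum_neg_distrib]
    refine sum_congr rfl fun w _ => ?_
    linear_combination (-y w) * hS.mul_self (hne w).1
  have qSz : q ⬝ᵥ (S *ᵥ z) = S u v * σ := by
    rw [hq, single_dotProduct, one_mul, mulVec, dotProduct, hrow, hσ, mul_sum]
    refine sum_congr rfl fun w _ => ?_
    have h1 : S u v * S v w * S u w = -1 := w.2
    have h2 := hS.mul_self huv
    linear_combination (-y w * S u v) * h1 + (S v w * S u w * y w) * h2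
  have zSz : z ⬝ᵥ (S *ᵥ z) = σ ^ 2 - y ⬝ᵥ y - 2 * (y ⬝ᵥ ((hS.linkGraph u v).adjMatrix ℝ *ᵥ y)) := by
    have h1 : z ⬝ᵥ (S *ᵥ z) = ∑ w : {w // seidelTriple S u v w = -1},
        ∑ x : {w // seidelTriple S u v w = -1}, y w * (seidelTriple S u w x * y x) := by
      rw [dotProduct_comm, dotProduct, hrow]
      refine sum_congr rfl fun w _ => ?_
      rw [mulVec, dotProduct, hrow, sum_mul]
      refine sum_congr rfl fun x _ => ?_
      simp only [seidelTriple]; ring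
    have h2 : ∀ w x : {w // seidelTriple S u v w = -1}, seidelTriple S u w x =
        1 - (if w = x then 1 else 0) - 2 * (hS.linkGraph u v).adjMatrix ℝ w x := by
      intro w x
      rw [SimpleGraph.adjMatrix_apply]
      by_cases hwx : w = x
      · subst hwx
        rw [if_pos rfl, if_neg (SimpleGraph.irrefl _)]
        simp [seidelTriple, hS.diag]
      · have hadj : (hS.linkGraph u v).Adj w x ↔ seidelTriple S u w x = -1 := Iff.rfl
        rcases hS.triple_eq (hne w).1 (fun h => hwx (Subtype.ext h)) (hne x).1 with h | h
        · rw [if_neg hwx, if_neg (by rw [hadj, h]; norm_num), h]; norm_num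
        · rw [if_neg hwx, if_pos (hadj.2 h), h]; norm_num
    rw [h1]
    simp only [h2, sub_mul, mul_sub, sum_sub_distrib, one_mul, ite_mul, zero_mul, mul_ite, mul_zero,
      sum_ite_eq, mem_univ, if_true]
    congr 1
    · congr 1
      rw [sq, hσ, sum_mul_sum]
    · simp only [dotProduct, mulVec, mul_sum]
      exact sum_congr rfl fun w _ => sum_congr rfl fun x _ => by ring
  have h2 := hS.mul_self huv
  -- The signs switch u to be adjacent to v and to the whole link set. A common weight t at u and v
  -- contributes 8t² - 4tσ, minimized at t = σ/4.
  have key := hS.dotProduct_mulVec_nonneg hmin ((σ / 4) • p + (-(S u v) * (σ / 4)) • q + z)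
  simp only [add_dotProduct, dotProduct_add, smul_dotProduct, dotProduct_smul, mulVec_add,
    mulVec_smul, smul_eq_mul, pp, qq, pq, qp, pz, qz, zz, dotProduct_comm z p, dotProduct_comm z q,
    pSp, qSq, pSq, comm q p, pSz, qSz, comm z p, comm z q, zSz] at key
  have h3 : (S u v * S u v) * σ ^ 2 = σ ^ 2 := by rw [h2, one_mul]
  linarith

theorem isLinkGraph (hS : IsSeidelMatrix S) (hmin : IsSmallestEigenvalue S (-5))
    (hω : switchingCliqueNum S = 4) (hα : switchingIndepNum S ≤ 28) {u v : V} (huv : u ≠ v)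
    [DecidablePred fun w => seidelTriple S u v w = -1] [DecidableRel (hS.linkGraph u v).Adj] :
    IsLinkGraph (hS.linkGraph u v) where
  triangleFree := by
    intro x y z hxy hyz hxz
    have dx := hS.ne_of_triple x.2
    have dy := hS.ne_of_triple y.2
    have dz := hS.ne_of_triple z.2
    have hxy' : seidelTriple S u x y = -1 := hxy
    have hyz' : seidelTriple S u y z = -1 := hyz
    have hxz' : seidelTriple S u x z = -1 := hxz
    have dxy := (hS.ne_of_triple hxy').2.1
    have dyz := (hS.ne_of_triple hyz').2.1
    have dxz := (hS.ne_of_triple hxz').2.1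
    have := hS.card_lt_cliqueNum_of_triple (u := u) (J := {v, x.1, y.1, z.1})
      (by simp [huv, dx.2.2, dy.2.2, dz.2.2]) (by
        intro i hi j hj hij
        simp only [mem_insert, mem_singleton] at hi hj
        rcases hi with rfl | rfl | rfl | rfl <;> rcases hj with rfl | rfl | rfl | rfl <;>
          first
            | exact absurd rfl hij
            | exact x.2
            | exact y.2
            | exact z.2
            | assumption
            | (rw [hS.triple_swap_right]
               first
                | exact x.2
                | exact y.2
                | exact z.2
                | assumption))
    have hc : #({v, x.1, y.1, z.1} : Finset V) = 4 := by
      rw [card_insert_of_notMem, card_insert_of_notMem, card_pair dyz]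
      · simp [dxy, dxz]
      · simp [dx.2.1, dy.2.1, dz.2.1]
    omega
  form_le := hS.linkGraph_form_le hmin huv
  indep_card_le := by
    intro s hs
    have hne : ∀ w : {w // seidelTriple S u v w = -1}, u ≠ w := fun w =>
      (hS.ne_of_triple w.2).2.2
    have := hS.card_lt_indepNum_of_triple (u := u) (J := s.map (Function.Embedding.subtype _))
      (fun h => by
        obtain ⟨w, -, hw⟩ := mem_map.1 h
        exact hne w hw.symm) (by
      intro i hi j hj hij
      obtain ⟨i', hi', rfl⟩ := mem_map.1 hi
      obtain ⟨j', hj', rfl⟩ := mem_map.1 hj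
      exact (hS.triple_eq (hne i') hij (hne j')).resolve_right (hs i' hi' j' hj'))
    rw [card_map] at this
    omega

end IsSeidelMatrix

theorem mainTheorem2 (n : ℕ) (S : Matrix (Fin n) (Fin n) ℝ) (hS : IsSeidelMatrix S)
    (hmin : IsSmallestEigenvalue S (-5)) (hω : switchingCliqueNum S = 4)
    (hα : switchingIndepNum S ≤ 28) : n ≤ 276 := by
  classical
  obtain ⟨u₀, v₀, w₀, h₀⟩ := hS.exists_triple (by omega)
  obtain ⟨⟨u, v, w⟩, ht, hmax⟩ := Finset.exists_max_image
    (Finset.univ.filter fun t : Fin n × Fin n × Fin n => seidelTriple S t.1 t.2.1 t.2.2 = -1)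
    (IsSeidelMatrix.commonCount S) ⟨(u₀, v₀, w₀), by simpa using h₀⟩
  have h : seidelTriple S u v w = -1 := by simpa using ht
  obtain ⟨huv, hvw, huw⟩ := hS.ne_of_triple h
  have hle : ∀ {a b : Fin n}, a ≠ b →
      3 * Fintype.card {x // seidelTriple S a b x = -1} ≤
        276 + 2 * IsSeidelMatrix.commonCount S (u, v, w) := by
    intro a b hab
    refine (hS.isLinkGraph hmin hω hα hab).three_mul_card_le fun x => ?_
    rw [hS.degree_linkGraph a b x]
    exact hmax (a, b, x.1) (by simpa using x.2)
  have h1 := hle huv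
  have h2 := hle huw
  have h3 := hle hvw
  have h4 := hS.card_add_two_mul_commonCount h
  rw [Fintype.card_fin] at h4
  omega
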